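/- \textbf{(Makkai–Paré) Filtered colimits in $\mathrm{Cat}$ are bicolimits.} Let $\mathrm{Cat}$ be the 2-category of small categories, let $J$ be a small filtered category, regarded as a locally discrete 2-category, let $D : J \to \mathrm{Cat}$ be a functor, and let $\Delta 1 : J^{op} \to \mathrm{Cat}$ be the weight constant at the terminal category $1$. For a category $A$ write $\mathrm{Cat}(D-,A) : J^{op} \to \mathrm{Cat}$ for the 2-functor $j \mapsto \mathrm{Cat}(Dj, A)$. For 2-functors $F,G : J^{op}\to\mathrm{Cat}$ let $[J^{op},\mathrm{Cat}](F,G)$ be the category of 2-natural transformations $F \to G$ and modifications, and let $Ps(J^{op},\mathrm{Cat})(F,G)$ be the category of pseudonatural transformations $F \to G$ and modifications. Suppose that a cocone, that is, a 2-natural transformation $\kappa : \Delta 1 \to \mathrm{Cat}(D-,L)$, exhibits the small category $L$ as the colimit of $D$ in the 2-category $\mathrm{Cat}$: for every small category $A$ the functor $$\mathrm{Cat}(L,A) \to [J^{op},\mathrm{Cat}](\Delta 1, \mathrm{Cat}(D-,A)), \qquad g \mapsto \mathrm{Cat}(D-,g)\circ\kappa,$$ is an isomorphism of categories. Then $\kappa$,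 regarded as a pseudococone, exhibits $L$ as the bicolimit of $D$: for every small category $A$ the composite functor $$\mathrm{Cat}(L,A) \to [J^{op},\mathrm{Cat}](\Delta 1, \mathrm{Cat}(D-,A)) \hookrightarrow Ps(J^{op},\mathrm{Cat})(\Delta 1, \mathrm{Cat}(D-,A))$$ is an equivalence of categories. -/

import Mathlib

open CategoryTheory Opposite

universe u

namespace TwoDim

open Bicategory Bicategory.Opposite
open scoped Pseudofunctor.StrongTrans

universe w₁ v₁ u₁ w₂ v₂ u₂

section TwoNatural

variable {B : Type u₁} [Bicategory.{w₁, v₁} B] {C : Type u₂} [Bicategory.{w₂, v₂} C]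

/-- A pseudonatural transformation is (strictly) 2-natural when each of its structural
2-isomorphisms `F.map f ≫ η.app b ≅ η.app a ≫ G.map f` is an identity 2-cell. -/
def IsTwoNatural {F G : B ⥤ᵖ C} : ObjectProperty (F ⟶ G) := fun η =>
  ∀ ⦃a b : B⦄ (f : a ⟶ b), ∃ h : F.map f ≫ η.app b = η.app a ≫ G.map f,
    η.naturality f = eqToIso h

/-- `Ps(B, C)(F, G)`: pseudonatural transformations and modifications. -/
abbrev PsHom (F G : StrictPseudofunctor B C) := F.toPseudofunctor ⟶ G.toPseudofunctor

/-- `[B, C](F, G)`: 2-natural transformations and modifications. -/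
abbrev TwoNat (F G : StrictPseudofunctor B C) :=
  (IsTwoNatural (F := F.toPseudofunctor) (G := G.toPseudofunctor)).FullSubcategory

/-- The inclusion `[B, C](F, G) ⥤ Ps(B, C)(F, G)`. -/
abbrev TwoNat.inclusion (F G : StrictPseudofunctor B C) : TwoNat F G ⥤ PsHom F G :=
  IsTwoNatural.ι

end TwoNatural

section Identities

variable {C : Type u₂} [Bicategory.{w₂, v₂} C]

/-- A 2-cell which is an identity, up to an equality of its source and target. -/
def IsEqToHom {a b : C} {f g : a ⟶ b} (θ : f ⟶ g) : Prop := ∃ h : f = g, θ = eqToHom h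

namespace IsEqToHom

lemma mk {a b : C} {f g : a ⟶ b} (h : f = g) : IsEqToHom (eqToHom h) := ⟨h, rfl⟩

lemma eq {a b : C} {f g : a ⟶ b} {θ θ' : f ⟶ g} (h : IsEqToHom θ) (h' : IsEqToHom θ') :
    θ = θ' := by
  obtain ⟨e, rfl⟩ := h
  obtain ⟨_, rfl⟩ := h'
  rfl

lemma comp {a b : C} {f g h : a ⟶ b} {θ : f ⟶ g} {θ' : g ⟶ h} (H : IsEqToHom θ)
    (H' : IsEqToHom θ') : IsEqToHom (θ ≫ θ') := by
  obtain ⟨rfl, rfl⟩ := H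
  obtain ⟨rfl, rfl⟩ := H'
  exact ⟨rfl, by simp⟩

lemma whiskerRight {a b c : C} {f g : a ⟶ b} {θ : f ⟶ g} (H : IsEqToHom θ) (x : b ⟶ c) :
    IsEqToHom (θ ▷ x) := by
  obtain ⟨rfl, rfl⟩ := H
  exact ⟨rfl, by simp⟩

lemma whiskerLeft {a b c : C} {f g : b ⟶ c} {θ : f ⟶ g} (H : IsEqToHom θ) (x : a ⟶ b) :
    IsEqToHom (x ◁ θ) := by
  obtain ⟨rfl, rfl⟩ := H
  exact ⟨rfl, by simp⟩

lemma inv {a b : C} {f g : a ⟶ b} {e : f ≅ g} (H : IsEqToHom e.hom) : IsEqToHom e.inv := by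
  obtain ⟨rfl, H⟩ := H
  refine ⟨rfl, ?_⟩
  rw [← cancel_epi e.hom, e.hom_inv_id, H]
  simp

variable [Strict C]

lemma associator {a b c d : C} (f : a ⟶ b) (g : b ⟶ c) (h : c ⟶ d) :
    IsEqToHom (α_ f g h).hom := ⟨Strict.assoc f g h, by rw [Strict.associator_eqToIso]; rfl⟩

lemma leftUnitor {a b : C} (f : a ⟶ b) : IsEqToHom (λ_ f).hom :=
  ⟨Strict.id_comp f, by rw [Strict.leftUnitor_eqToIso]; rfl⟩

lemma rightUnitor {a b : C} (f : a ⟶ b) : IsEqToHom (ρ_ f).hom :=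
  ⟨Strict.comp_id f, by rw [Strict.rightUnitor_eqToIso]; rfl⟩

end IsEqToHom

lemma isTwoNatural_iff {B : Type u₁} [Bicategory.{w₁, v₁} B] {F G : B ⥤ᵖ C} (η : F ⟶ G) :
    IsTwoNatural η ↔ ∀ ⦃a b : B⦄ (f : a ⟶ b), IsEqToHom (η.naturality f).hom :=
  ⟨fun h a b f => by obtain ⟨e, he⟩ := h f; exact ⟨e, by rw [he]; rfl⟩,
    fun h a b f => by obtain ⟨e, he⟩ := h f; exact ⟨e, Iso.ext he⟩⟩

/-- 2-natural transformations are closed under composition. -/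
lemma IsTwoNatural.comp [Strict C] {B : Type u₁} [Bicategory.{w₁, v₁} B] {F G H : B ⥤ᵖ C}
    {η : F ⟶ G} {θ : G ⟶ H} (hη : IsTwoNatural η) (hθ : IsTwoNatural θ) :
    IsTwoNatural (η ≫ θ) := by
  rw [isTwoNatural_iff] at *
  intro a b f
  rw [Pseudofunctor.StrongTrans.categoryStruct_comp_naturality_hom]
  exact ((IsEqToHom.associator _ _ _).inv).comp <| ((hη f).whiskerRight _).comp <|
    (IsEqToHom.associator _ _ _).comp <| ((hθ f).whiskerLeft _).comp
      (IsEqToHom.associator _ _ _).inv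

/-- A 2-cell of `Cat` whose components are identities is an identity. -/
lemma isEqToHom_cat {X Y : Cat.{w₂, v₂}} {F G : X ⟶ Y} (e : F ≅ G)
    (h : ∀ x, ∃ hx : F.toFunctor.obj x = G.toFunctor.obj x,
      e.hom.toNatTrans.app x = eqToHom hx) : IsEqToHom e.hom := by
  have hFG : F = G := Cat.ext (Functor.ext_of_iso (Cat.Hom.toNatIso e)
    (fun x => (h x).1) (fun x => (h x).2))
  refine ⟨hFG, ?_⟩
  subst hFG
  ext x
  simpa using (h x).2

variable [Strict C]

lemma precomposingCat_id (a A : C) : (precomposingCat a a A).obj (𝟙 a) = 𝟙 (Cat.of (a ⟶ A)) :=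
  (isEqToHom_cat (leftUnitorNatIsoCat a A) (fun x => IsEqToHom.leftUnitor (C := C) x)).1

lemma precomposingCat_comp {a b c : C} (f : a ⟶ b) (g : b ⟶ c) (A : C) :
    (precomposingCat a c A).obj (f ≫ g) =
      (precomposingCat b c A).obj g ≫ (precomposingCat a b A).obj f :=
  (isEqToHom_cat (associatorNatIsoRightCat f g A) (fun x => IsEqToHom.associator f g x)).1

/-- In a 2-category, pre- and postcomposition commute strictly. -/
lemma isEqToHom_associatorNatIsoMiddleCat {a b c d : C} (f : a ⟶ b) (h : c ⟶ d) :
    IsEqToHom (associatorNatIsoMiddleCat f h).hom :=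
  isEqToHom_cat _ (fun x => IsEqToHom.associator f x h)

lemma precomposingCat_whisker_left {a b c A : C} {g g' : a ⟶ b} (θ : g ⟶ g') (f : b ⟶ c)
    {k k' : a ⟶ c} (h : k = g ≫ f) (h' : g' ≫ f = k')
    (e : (precomposingCat a c A).obj k = (precomposingCat b c A).obj f ≫
      (precomposingCat a b A).obj g)
    (e' : (precomposingCat b c A).obj f ≫ (precomposingCat a b A).obj g' =
      (precomposingCat a c A).obj k') :
    (precomposingCat a c A).map (eqToHom h ≫ θ ▷ f ≫ eqToHom h') =
      eqToHom e ≫ (precomposingCat b c A).obj f ◁ (precomposingCat a b A).map θ ≫ eqToHom e' := by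
  subst h h'
  have h1 : eqToHom e = (associatorNatIsoRightCat g f A).hom :=
    (IsEqToHom.mk e).eq (isEqToHom_cat _ (fun x => IsEqToHom.associator g f x))
  have h2 : eqToHom e' = (associatorNatIsoRightCat g' f A).inv :=
    (IsEqToHom.mk e').eq (isEqToHom_cat (associatorNatIsoRightCat g' f A)
      (fun x => IsEqToHom.associator g' f x)).inv
  rw [h1, h2]
  refine Cat.Hom₂.ext (NatTrans.ext (funext fun (x : c ⟶ A) => ?_))
  change (𝟙 _ ≫ θ ▷ f ≫ 𝟙 _) ▷ x = (α_ g f x).hom ≫ θ ▷ (f ≫ x) ≫ (α_ g' f x).inv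
  simp

lemma precomposingCat_whisker_right {a b c A : C} {g g' : b ⟶ c} (θ : g ⟶ g') (f : a ⟶ b)
    {k k' : a ⟶ c} (h : k = f ≫ g) (h' : f ≫ g' = k')
    (e : (precomposingCat a c A).obj k = (precomposingCat b c A).obj g ≫
      (precomposingCat a b A).obj f)
    (e' : (precomposingCat b c A).obj g' ≫ (precomposingCat a b A).obj f =
      (precomposingCat a c A).obj k') :
    (precomposingCat a c A).map (eqToHom h ≫ f ◁ θ ≫ eqToHom h') =
      eqToHom e ≫ (precomposingCat b c A).map θ ▷ (precomposingCat a b A).obj f ≫ eqToHom e' := by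
  subst h h'
  have h1 : eqToHom e = (associatorNatIsoRightCat f g A).hom :=
    (IsEqToHom.mk e).eq (isEqToHom_cat _ (fun x => IsEqToHom.associator f g x))
  have h2 : eqToHom e' = (associatorNatIsoRightCat f g' A).inv :=
    (IsEqToHom.mk e').eq (isEqToHom_cat (associatorNatIsoRightCat f g' A)
      (fun x => IsEqToHom.associator f g' x)).inv
  rw [h1, h2]
  refine Cat.Hom₂.ext (NatTrans.ext (funext fun (x : c ⟶ A) => ?_))
  change (𝟙 _ ≫ f ◁ θ ≫ 𝟙 _) ▷ x = (α_ f g x).hom ≫ f ◁ (θ ▷ x) ≫ (α_ f g' x).inv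
  simp

end Identities

section HomDiagram

variable {J : Type u₁} [Bicategory.{w₁, v₁} J] [Strict J]
  {C : Type u₂} [Bicategory.{w₂, v₂} C] [Strict C]

/-- The 2-functor `C(D-, A) : J ⥤ Cat` attached to a 2-functor `D : Jᵒᵖ ⥤ C` and an object `A`. -/
def homDiagram (D : StrictPseudofunctor Jᵒᵖ C) (A : C) : StrictPseudofunctor J Cat.{w₂, v₂} :=
  StrictPseudofunctor.mk''
    { obj := fun j => Cat.of (D.obj (op j) ⟶ A)
      map := fun f => (precomposingCat _ _ A).obj (D.map f.op)
      map₂ := fun η => (precomposingCat _ _ A).map (D.map₂ (op2 η))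
      map₂_id := by
        intro a b f
        rw [op2_id, D.map₂_id, CategoryTheory.Functor.map_id]
      map₂_comp := by
        intro a b f g h η θ
        rw [op2_comp, D.map₂_comp, CategoryTheory.Functor.map_comp]
      map_id := by
        intro X
        rw [op_id, D.map_id, precomposingCat_id]
      map_comp := by
        intro a b c f g
        rw [op_comp, D.map_comp, precomposingCat_comp]
      map₂_whisker_left := by
        intro a b c f g h η
        rw [op2_whiskerLeft, D.map₂_whisker_right, D.mapComp_eq_eqToIso, D.mapComp_eq_eqToIso]
        exact precomposingCat_whisker_left _ _ (D.map_comp _ _) (D.map_comp _ _).symm _ _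
      map₂_whisker_right := by
        intro a b c f g η h
        rw [op2_whiskerRight, D.map₂_whisker_left, D.mapComp_eq_eqToIso, D.mapComp_eq_eqToIso]
        exact precomposingCat_whisker_right _ _ (D.map_comp _ _) (D.map_comp _ _).symm _ _ }

/-- Postcomposition with `g : L ⟶ A`, as a pseudonatural transformation `C(D-, L) ⟶ C(D-, A)`.
Its structural 2-cells are the associators of the 2-category `C`, which are identities. -/
def homDiagramMap (D : StrictPseudofunctor Jᵒᵖ C) {L A : C} (g : L ⟶ A) :
    PsHom (homDiagram D L) (homDiagram D A) where
  app j := (postcomposingCat (D.obj (op j)) L A).obj g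
  naturality f := associatorNatIsoMiddleCat (D.map f.op) g
  naturality_naturality := by
    intro a b f h η
    refine Cat.Hom₂.ext (NatTrans.ext (funext fun (x : D.obj (op a) ⟶ L) => ?_))
    exact associator_naturality_left (D.map₂ (op2 η)) x g
  naturality_id a := IsEqToHom.eq
    ((isEqToHom_associatorNatIsoMiddleCat _ g).comp ((IsEqToHom.mk ((homDiagram D A).map_id a)).whiskerLeft _))
    (((IsEqToHom.mk ((homDiagram D L).map_id a)).whiskerRight _).comp
      ((IsEqToHom.leftUnitor _).comp (IsEqToHom.rightUnitor _).inv))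
  naturality_comp f h := IsEqToHom.eq
    ((isEqToHom_associatorNatIsoMiddleCat _ g).comp ((IsEqToHom.mk ((homDiagram D A).map_comp f h)).whiskerLeft _))
    (((IsEqToHom.mk ((homDiagram D L).map_comp f h)).whiskerRight _).comp <| (IsEqToHom.associator _ _ _).comp <|
      ((isEqToHom_associatorNatIsoMiddleCat _ g).whiskerLeft _).comp <|
      (IsEqToHom.associator _ _ _).inv.comp <|
      ((isEqToHom_associatorNatIsoMiddleCat _ g).whiskerRight _).comp
      (IsEqToHom.associator _ _ _))

lemma homDiagramMap_isTwoNatural (D : StrictPseudofunctor Jᵒᵖ C) {L A : C} (g : L ⟶ A) :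
    IsTwoNatural (homDiagramMap D g) :=
  (isTwoNatural_iff _).2 fun _ _ f => isEqToHom_associatorNatIsoMiddleCat (D.map f.op) g

/-- The functor `C(L, A) ⥤ Ps(J, Cat)(C(D-, L), C(D-, A))` given by postcomposition. -/
def homDiagramFunctor (D : StrictPseudofunctor Jᵒᵖ C) (L A : C) :
    (L ⟶ A) ⥤ PsHom (homDiagram D L) (homDiagram D A) where
  obj g := homDiagramMap D g
  map {g g'} η := ⟨{
    app := fun j => (postcomposingCat (D.obj (op j)) L A).map η
    naturality := by
      intro a b f
      refine Cat.Hom₂.ext (NatTrans.ext (funext fun (x : D.obj (op a) ⟶ L) => ?_))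
      change (D.map f.op ≫ x) ◁ η ≫ (α_ _ _ _).hom = (α_ _ _ _).hom ≫ D.map f.op ◁ x ◁ η
      simp }⟩
  map_id g := by
    ext j : 1
    exact (postcomposingCat (D.obj (op j)) L A).map_id g
  map_comp η θ := by
    ext j : 1
    exact (postcomposingCat (D.obj (op j)) L A).map_comp η θ

end HomDiagram

section Colimits

variable {J : Type u₁} [Bicategory.{w₁, v₁} J] [Strict J]
  {C : Type u₂} [Bicategory.{w₂, v₂} C] [Strict C]
  {W : StrictPseudofunctor J Cat.{w₂, v₂}} {D : StrictPseudofunctor Jᵒᵖ C} {L : C}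

/-- For a pseudococone `κ : W ⟶ C(D-, L)`, the induced functor
`C(L, A) ⥤ Ps(J, Cat)(W, C(D-, A))`, `g ↦ C(D-, g) ∘ κ`. -/
def inducedPs (κ : PsHom W (homDiagram D L)) (A : C) : (L ⟶ A) ⥤ PsHom W (homDiagram D A) :=
  homDiagramFunctor D L A ⋙ precomp (homDiagram D A).toPseudofunctor κ

/-- For a cocone, i.e. a 2-natural `κ : W ⟶ C(D-, L)`, the induced functor
`C(L, A) ⥤ [J, Cat](W, C(D-, A))`, `g ↦ C(D-, g) ∘ κ`. -/
def inducedStrict (κ : TwoNat W (homDiagram D L)) (A : C) : (L ⟶ A) ⥤ TwoNat W (homDiagram D A) :=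
  IsTwoNatural.lift (inducedPs κ.obj A)
    (fun g => IsTwoNatural.comp κ.property (homDiagramMap_isTwoNatural D g))

/-- The pseudococone `κ` exhibits `L` as the `W`-weighted bicolimit of `D`: the induced functors
are equivalences of categories. -/
def IsWeightedBicolimit (κ : PsHom W (homDiagram D L)) : Prop :=
  ∀ A : C, (inducedPs κ A).IsEquivalence

/-- The cocone `κ` exhibits `L` as the (genuine) `W`-weighted colimit of `D`: the induced functors
are isomorphisms of categories. -/
def IsWeightedColimit (κ : TwoNat W (homDiagram D L)) : Prop :=
  ∀ A : C, ∃ G : TwoNat W (homDiagram D A) ⥤ (L ⟶ A),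
    inducedStrict κ A ⋙ G = 𝟭 _ ∧ G ⋙ inducedStrict κ A = 𝟭 _

variable (C W) in
/-- `W`-colimits are bicolimits in the 2-category `C`: whenever a cocone exhibits `L` as the
`W`-colimit of a 2-functor `D : Jᵒᵖ ⥤ C`, it also exhibits `L` as the `W`-bicolimit of `D`. -/
def ColimitsAreBicolimits : Prop :=
  ∀ (D : StrictPseudofunctor Jᵒᵖ C) (L : C) (κ : TwoNat W (homDiagram D L)),
    IsWeightedColimit κ → IsWeightedBicolimit ((TwoNat.inclusion _ _).obj κ)

variable (J) in
/-- The weight for conical `Jᵒᵖ`-indexed colimits: the 2-functor `J ⥤ Cat` which is constant at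
the terminal category. -/
def conicalWeight : StrictPseudofunctor J Cat.{v₂, v₂} :=
  StrictPseudofunctor.mk''
    { obj := fun _ => Cat.of (Discrete PUnit.{v₂ + 1})
      map := fun _ => 𝟙 _
      map₂ := fun _ => 𝟙 _ }

end Colimits

end TwoDim

/-!
Let `T : J ⥤ Cat` be the diagram underlying `D`. A pseudococone from `T` to `A` consists of functors
`φ j : T j ⥤ A` and coherent isomorphisms `σ f : φ j ≅ T f ⋙ φ k` for `f : j ⟶ k`. The point is that
every pseudococone is isomorphic to a strict one (`exists_strictification`).

On objects, `φ` and `σ` form a functor `Φ` from the category of elements of `j ↦ Ob (T j)` to `A`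
which inverts every morphism. Two elements with the same class in `colim_j Ob (T j)` admit a cospan,
and since `J` is filtered any two such cospans embed in a common one, so that the isomorphism in `A`
obtained from a cospan does not depend on it (`map_comp_inv_map_eq`). Hence, after choosing a
representative of each class, `Φ` is isomorphic to a family depending on the class only, compatibly
with the transition isomorphisms (`exists_descent`). Transporting each `φ j` along these isomorphisms
gives functors `ψ j ≅ φ j` with `ψ j = T f ⋙ ψ k` on the nose, under which `σ f` becomes an identity.

It follows that the fully faithful inclusion of 2-natural transformations into pseudonatural ones is
essentially surjective here, hence an equivalence for every `A`. Composed with the isomorphism given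
by the universal property of the colimit, it is an equivalence, so the colimit is a bicolimit.
No explicit description of `L` is needed.
-/

namespace TwoDim
open Limits

/-! ### Descent along a filtered colimit of sets -/

section Elements

variable {J : Type u} [SmallCategory J] [IsFiltered J] {F : J ⥤ Type u}
  {A : Type*} [Category* A] (Φ : F.Elements ⥤ A)
  [∀ {p q : F.Elements} (m : p ⟶ q), IsIso (Φ.map m)]

lemma exists_cospan_of_ι_eq {p q : F.Elements} (h : colimit.ι F p.1 p.2 = colimit.ι F q.1 q.2) :
    ∃ r : F.Elements, Nonempty (p ⟶ r) ∧ Nonempty (q ⟶ r) := by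
  obtain ⟨k, f, g, e⟩ := (Types.FilteredColimit.colimit_eq_iff F).1 h
  exact ⟨⟨k, F.map f p.2⟩, ⟨⟨f, rfl⟩⟩, ⟨⟨g, e.symm⟩⟩⟩

/-- A functor inverting all morphisms of the category of elements sends all cospans between two given
elements to the same isomorphism, as any two of them embed in a common cospan. -/
lemma map_comp_inv_map_eq {p q r s : F.Elements} (f : p ⟶ r) (g : q ⟶ r) (f' : p ⟶ s)
    (g' : q ⟶ s) : Φ.map f ≫ inv (Φ.map g) = Φ.map f' ≫ inv (Φ.map g') := by
  obtain ⟨k, a, b, h₁, h₂⟩ := IsFiltered.bowtie f.1 f'.1 g.1 g'.1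
  let t : F.Elements := ⟨k, F.map a r.2⟩
  let a' : r ⟶ t := ⟨a, rfl⟩
  let b' : s ⟶ t := ⟨b, by
    dsimp [t]
    rw [← f.2, ← f'.2]
    simpa using congrArg (fun m => F.map m p.2) h₁.symm⟩
  have e₁ : f ≫ a' = f' ≫ b' := Subtype.ext h₁
  have e₂ : g ≫ a' = g' ≫ b' := Subtype.ext h₂
  have E₁ := congrArg Φ.map e₁
  have E₂ := congrArg Φ.map e₂
  simp only [Functor.map_comp] at E₁ E₂
  rw [IsIso.comp_inv_eq, Category.assoc, ← cancel_mono (Φ.map a'), Category.assoc, Category.assoc,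
    E₁, E₂]
  simp

/-- A functor inverting all morphisms of the category of elements is isomorphic to a family indexed by
the colimit, with identities as transition morphisms. -/
lemma exists_descent :
    ∃ (Ψ : colimit F → A) (α : ∀ p : F.Elements, Φ.obj p ≅ Ψ (colimit.ι F p.1 p.2)),
      ∀ {p q : F.Elements} (m : p ⟶ q) (h : colimit.ι F q.1 q.2 = colimit.ι F p.1 p.2),
      Φ.map m ≫ (α q).hom ≫ eqToHom (congrArg Ψ h) = (α p).hom := by
  have H : ∀ z : colimit F, ∃ p : F.Elements, colimit.ι F p.1 p.2 = z := fun z => by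
    obtain ⟨j, y, h⟩ := Types.jointly_surjective' z
    exact ⟨⟨j, y⟩, h⟩
  choose rep hrep using H
  choose top f g using fun p : F.Elements =>
    exists_cospan_of_ι_eq (hrep (colimit.ι F p.1 p.2)).symm
  refine ⟨fun z => Φ.obj (rep z), fun p => asIso (Φ.map (f p).some) ≪≫
    (asIso (Φ.map (g p).some)).symm, ?_⟩
  intro p q m h
  -- The representatives of the classes of `p` and `q` are only propositionally equal, so the
  -- comparison is made with two equal elements `r` and `r'` in their place.
  have key : ∀ (r r' s s' : F.Elements) (e : r = r') (f : q ⟶ s) (g : r ⟶ s) (f' : p ⟶ s')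
      (g' : r' ⟶ s'), Φ.map m ≫ (Φ.map f ≫ inv (Φ.map g)) ≫ eqToHom (congrArg Φ.obj e) =
        Φ.map f' ≫ inv (Φ.map g') := by
    rintro r _ s s' rfl f g f' g'
    rw [← map_comp_inv_map_eq Φ (m ≫ f) g f' g']
    simp
  exact key _ _ _ _ (congrArg rep h) _ _ _ _

end Elements

/-! ### Strictification of pseudococones -/

section Strictify

open Bicategory
variable {J : Type u} [SmallCategory J] [IsFiltered J]

/-- Every pseudococone `(φ, σ)` under a filtered diagram `T` of categories is isomorphic to a strict
cocone `ψ`. -/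
lemma exists_strictification (T : J ⥤ Cat.{u, u}) (A : Cat.{u, u}) (φ : ∀ j, T.obj j ⟶ A)
    (σ : ∀ {j k : J} (f : j ⟶ k), φ j ≅ T.map f ≫ φ k)
    (σ_id : ∀ j, IsEqToHom (σ (𝟙 j)).hom)
    (σ_comp : ∀ {i j k : J} (f : i ⟶ j) (g : j ⟶ k)
      (h : T.map f ≫ T.map g ≫ φ k = T.map (f ≫ g) ≫ φ k),
      (σ (f ≫ g)).hom = (σ f).hom ≫ T.map f ◁ (σ g).hom ≫ eqToHom h) :
    ∃ (ψ : ∀ j, T.obj j ⟶ A) (h : ∀ {j k : J} (f : j ⟶ k), ψ j = T.map f ≫ ψ k)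
      (θ : ∀ j, ψ j ≅ φ j), ∀ {j k : J} (f : j ⟶ k),
        (θ j).hom ≫ (σ f).hom = eqToHom (h f) ≫ T.map f ◁ (θ k).hom := by
  let F := T ⋙ Cat.objects
  have hid : ∀ (j : J) (x : T.obj j) (e : (T.map (𝟙 j)).toFunctor.obj x = x),
      (σ (𝟙 j)).hom.toNatTrans.app x ≫ eqToHom (congrArg (φ j).toFunctor.obj e) = 𝟙 _ := by
    intro j x e
    obtain ⟨h, e⟩ := σ_id j
    rw [e, Cat.eqToHom_app]
    exact eqToHom_trans _ _
  have hcomp : ∀ {i j k : J} (f : i ⟶ j) (g : j ⟶ k) (x : T.obj i) (y : T.obj j) (z : T.obj k)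
      (e : (T.map f).toFunctor.obj x = y) (e' : (T.map g).toFunctor.obj y = z)
      (e'' : (T.map (f ≫ g)).toFunctor.obj x = z),
      (σ (f ≫ g)).hom.toNatTrans.app x ≫ eqToHom (congrArg (φ k).toFunctor.obj e'') =
        ((σ f).hom.toNatTrans.app x ≫ eqToHom (congrArg (φ j).toFunctor.obj e)) ≫
        (σ g).hom.toNatTrans.app y ≫ eqToHom (congrArg (φ k).toFunctor.obj e') := by
    rintro i j k f g x _ _ rfl rfl e''
    rw [σ_comp f g (by simp), Cat.Hom₂.comp_app, Cat.Hom₂.comp_app, Cat.eqToHom_app,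
      Cat.whiskerLeft_app]
    simp
  let Φ : F.Elements ⥤ A :=
    { obj := fun p => (φ p.1).toFunctor.obj p.2
      map := fun {p q} m => (σ m.1).hom.toNatTrans.app p.2 ≫
        eqToHom (congrArg (φ q.1).toFunctor.obj m.2)
      map_id := fun p => hid p.1 p.2 (𝟙 p : p ⟶ p).2
      map_comp := fun {p q r} f g => hcomp f.1 g.1 p.2 q.2 r.2 f.2 g.2 (f ≫ g).2 }
  have : ∀ {p q : F.Elements} (m : p ⟶ q), IsIso (Φ.map m) := by
    intro p q m
    have : IsIso ((σ m.1).hom.toNatTrans.app p.2) :=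
      ((Cat.Hom.toNatIso (σ m.1)).app p.2).isIso_hom
    exact IsIso.comp_isIso
  obtain ⟨Ψ, α, hα⟩ := exists_descent Φ
  -- The isomorphisms `β j x` transport each `φ j` to a functor whose values on objects depend only
  -- on classes in the colimit of the sets of objects.
  let cl (j : J) (x : T.obj j) : colimit F := colimit.ι F j x
  let β (j : J) (x : T.obj j) : (φ j).toFunctor.obj x ≅ Ψ (cl j x) := α ⟨j, x⟩
  have hcl : ∀ {j k : J} (f : j ⟶ k) (x : T.obj j), cl k ((T.map f).toFunctor.obj x) = cl j x :=
    fun f x => ConcreteCategory.congr_hom (colimit.w F f) x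
  have hβ : ∀ {j k : J} (f : j ⟶ k) (x : T.obj j),
      (σ f).hom.toNatTrans.app x ≫ (β k ((T.map f).toFunctor.obj x)).hom ≫
        eqToHom (congrArg Ψ (hcl f x)) = (β j x).hom := by
    intro j k f x
    have := @hα ⟨j, x⟩ ⟨k, (T.map f).toFunctor.obj x⟩ ⟨f, rfl⟩ (hcl f x)
    simpa [Φ] using this
  let ψ (j : J) : T.obj j ⟶ A := Functor.toCatHom
    { obj := fun x => Ψ (cl j x)
      map := fun {x y} m => (β j x).inv ≫ (φ j).toFunctor.map m ≫ (β j y).hom }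
  let θ (j : J) : ψ j ≅ φ j := Cat.Hom.isoMk (NatIso.ofComponents (fun x => (β j x).symm) (by
    intro x y m
    simp))
  have hβ' : ∀ {j k : J} (f : j ⟶ k) (x : T.obj j),
      (β j x).inv ≫ (σ f).hom.toNatTrans.app x =
        eqToHom (congrArg Ψ (hcl f x).symm) ≫ (β k ((T.map f).toFunctor.obj x)).inv := by
    intro j k f x
    rw [Iso.inv_comp_eq, ← hβ f x]
    simp
  have hψ : ∀ {j k : J} (f : j ⟶ k), ψ j = T.map f ≫ ψ k := by
    intro j k f
    refine Cat.ext (CategoryTheory.Functor.ext (fun x => congrArg Ψ (hcl f x).symm) ?_)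
    intro x y m
    change (β j x).inv ≫ (φ j).toFunctor.map m ≫ (β j y).hom = eqToHom _ ≫
      ((β k _).inv ≫ (φ k).toFunctor.map ((T.map f).toFunctor.map m) ≫ (β k _).hom) ≫ eqToHom _
    rw [← hβ f y, Category.assoc, ← reassoc_of% (hβ' f x)]
    have := (σ f).hom.toNatTrans.naturality m
    dsimp at this
    rw [reassoc_of% this, Category.assoc]
  refine ⟨ψ, hψ, θ, ?_⟩
  intro j k f
  refine Cat.Hom₂.ext (NatTrans.ext (funext fun x => ?_))
  rw [Cat.Hom₂.comp_app, Cat.Hom₂.comp_app, Cat.eqToHom_app]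
  exact hβ' f x

end Strictify

/-! ### Pseudonatural transformations out of the conical weight -/

section Pseudo
open Bicategory
open scoped Pseudofunctor.StrongTrans
variable {J : Type u} [SmallCategory J]

/-- The functor `J ⥤ Cat` given by a 2-functor `D` on `(LocallyDiscrete Jᵒᵖ)ᵒᵖ`, the form in which
`homDiagram` takes a diagram indexed by `J`. -/
def underlyingFunctor (D : StrictPseudofunctor (LocallyDiscrete Jᵒᵖ)ᵒᵖ Cat.{u, u}) :
    J ⥤ Cat.{u, u} where
  obj j := D.obj (op ⟨op j⟩)
  map {j k} f := D.map (Quiver.Hom.op (X := (⟨op k⟩ : LocallyDiscrete Jᵒᵖ)) (Y := ⟨op j⟩) ⟨f.op⟩)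
  map_id _ := D.map_id _
  map_comp {i j k} f g := D.map_comp
    (Quiver.Hom.op (X := (⟨op j⟩ : LocallyDiscrete Jᵒᵖ)) (Y := ⟨op i⟩) ⟨f.op⟩)
    (Quiver.Hom.op (X := (⟨op k⟩ : LocallyDiscrete Jᵒᵖ)) (Y := ⟨op j⟩) ⟨g.op⟩)

/-- The components of an identity 2-cell between functors into a hom-category `a ⟶ A` are identity
2-cells. -/
lemma IsEqToHom.cat_app {X a A : Cat.{u, u}} {F G : X ⟶ Cat.of (a ⟶ A)} {θ : F ⟶ G}
    (h : IsEqToHom θ) (x : X) : IsEqToHom (C := Cat.{u, u}) (a := a) (b := A)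
      (f := F.toFunctor.obj x) (g := G.toFunctor.obj x) (θ.toNatTrans.app x) := by
  obtain ⟨rfl, rfl⟩ := h
  exact ⟨rfl, rfl⟩

/-- The object of the terminal category. -/
abbrev pt : Discrete PUnit.{u + 1} := ⟨⟨⟩⟩

lemma cat_ext_of_terminal {X : Cat.{u, u}} {F G : Cat.of (Discrete PUnit.{u + 1}) ⟶ X}
    (h : F.toFunctor.obj pt = G.toFunctor.obj pt) : F = G :=
  Cat.ext (Discrete.functor_ext (fun _ => h))

/-- Over a filtered category, every pseudonatural transformation from the conical weight to
`homDiagram D A` is isomorphic to a 2-natural one. -/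
lemma exists_iso_isTwoNatural [IsFiltered J]
    (D : StrictPseudofunctor (LocallyDiscrete Jᵒᵖ)ᵒᵖ Cat.{u, u}) (A : Cat.{u, u})
    (η : PsHom (conicalWeight (LocallyDiscrete Jᵒᵖ)) (homDiagram D A)) :
    ∃ ζ : PsHom (conicalWeight (LocallyDiscrete Jᵒᵖ)) (homDiagram D A),
      IsTwoNatural ζ ∧ Nonempty (ζ ≅ η) := by
  let W : StrictPseudofunctor (LocallyDiscrete Jᵒᵖ) Cat.{u, u} :=
    conicalWeight (LocallyDiscrete Jᵒᵖ)
  let T := underlyingFunctor D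
  let φ (j : J) : T.obj j ⟶ A := (η.app ⟨op j⟩).toFunctor.obj pt
  let σ {j k : J} (f : j ⟶ k) : φ j ≅ T.map f ≫ φ k :=
    (Cat.Hom.toNatIso
      (η.naturality (a := (⟨op k⟩ : LocallyDiscrete Jᵒᵖ)) (b := ⟨op j⟩) ⟨f.op⟩)).app pt
  have σ_id (j : J) : IsEqToHom (σ (𝟙 j)).hom := by
    let a : LocallyDiscrete Jᵒᵖ := ⟨op j⟩
    -- The unit axiom of `η`, evaluated at the point: `c₁` and `c₂` come from the unit constraints of
    -- `homDiagram D A` and of the weight, and are identities.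
    let c₁ : T.map (𝟙 j) ≫ φ j ⟶ φ j := ((homDiagram D A).mapId a).hom.toNatTrans.app (φ j)
    let c₂ : φ j ⟶ φ j := ((W.mapId a).hom ▷ η.app a).toNatTrans.app pt
    have h₁ : IsEqToHom c₁ :=
      IsEqToHom.cat_app (X := (homDiagram D A).obj a) (a := T.obj j) (A := A)
        (IsEqToHom.mk ((homDiagram D A).map_id a)) (φ j)
    have h₂ : IsEqToHom c₂ :=
      ((IsEqToHom.mk (W.map_id a)).whiskerRight (η.app a)).cat_app (a := T.obj j) (A := A) pt
    have key : (σ (𝟙 j)).hom ≫ c₁ = c₂ ≫ 𝟙 (φ j) ≫ 𝟙 (φ j) :=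
      congrArg (fun t => t.toNatTrans.app pt) (η.naturality_id a)
    obtain ⟨e, h₁⟩ := h₁
    rw [h₂.eq (IsEqToHom.mk rfl), h₁] at key
    refine ⟨e.symm, ?_⟩
    rw [← cancel_mono (eqToHom e), key]
    simp
  have σ_comp {i j k : J} (f : i ⟶ j) (g : j ⟶ k)
      (h : T.map f ≫ T.map g ≫ φ k = T.map (f ≫ g) ≫ φ k) :
      (σ (f ≫ g)).hom = (σ f).hom ≫ T.map f ◁ (σ g).hom ≫ eqToHom h := by
    let f' : (⟨op j⟩ : LocallyDiscrete Jᵒᵖ) ⟶ ⟨op i⟩ := ⟨f.op⟩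
    let g' : (⟨op k⟩ : LocallyDiscrete Jᵒᵖ) ⟶ ⟨op j⟩ := ⟨g.op⟩
    -- The composition axiom of `η`, evaluated at the point: `c₁` and `c₂` come from the composition
    -- constraints of `homDiagram D A` and of the weight, and are identities.
    let c₁ : T.map (f ≫ g) ≫ φ k ⟶ T.map f ≫ T.map g ≫ φ k :=
      ((homDiagram D A).mapComp g' f').hom.toNatTrans.app (φ k)
    let c₂ : φ i ⟶ φ i := ((W.mapComp g' f').hom ▷ η.app ⟨op i⟩).toNatTrans.app pt
    have h₁ : IsEqToHom c₁ :=
      IsEqToHom.cat_app (X := (homDiagram D A).obj ⟨op k⟩) (a := T.obj i) (A := A)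
        (IsEqToHom.mk ((homDiagram D A).map_comp g' f')) (φ k)
    have h₂ : IsEqToHom c₂ :=
      ((IsEqToHom.mk (W.map_comp g' f')).whiskerRight (η.app ⟨op i⟩)).cat_app
        (a := T.obj i) (A := A) pt
    have key : (σ (f ≫ g)).hom ≫ c₁ =
        c₂ ≫ 𝟙 _ ≫ (σ f).hom ≫ 𝟙 _ ≫ T.map f ◁ (σ g).hom ≫ 𝟙 _ :=
      congrArg (fun t => t.toNatTrans.app pt) (η.naturality_comp g' f')
    rw [h₂.eq (IsEqToHom.mk rfl), h₁.eq (IsEqToHom.mk h.symm)] at key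
    rw [← cancel_mono (eqToHom h.symm), key]
    simp
  obtain ⟨ψ, h, θ, hθ⟩ := exists_strictification T A φ σ σ_id σ_comp
  -- The strict cocone `ψ`, as a 2-natural transformation `ζ` with components `ap`.
  let ap (a : LocallyDiscrete Jᵒᵖ) : W.obj a ⟶ (homDiagram D A).obj a :=
    ((Functor.const (Discrete PUnit.{u + 1})).obj (ψ a.as.unop) :
      Discrete PUnit.{u + 1} ⥤ (D.obj (op a) ⟶ A)).toCatHom
  have hnat {a b : LocallyDiscrete Jᵒᵖ} (f : a ⟶ b) :
      W.map f ≫ ap b = ap a ≫ (homDiagram D A).map f :=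
    cat_ext_of_terminal (h f.as.unop)
  -- Up to equalities of 1-cells, both sides of each axiom of `ζ` are composites of identity 2-cells.
  let ζ : PsHom W (homDiagram D A) :=
    { app := ap
      naturality := fun f => eqToIso (hnat f)
      naturality_naturality := by
        intro a b f g t
        obtain rfl := LocallyDiscrete.eq_of_hom t
        obtain rfl : t = 𝟙 _ := Subsingleton.elim _ _
        simp
      naturality_id a := IsEqToHom.eq
        ((IsEqToHom.mk (hnat _)).comp ((IsEqToHom.mk ((homDiagram D A).map_id a)).whiskerLeft _))
        (((IsEqToHom.mk (W.map_id a)).whiskerRight _).comp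
          ((IsEqToHom.leftUnitor _).comp (IsEqToHom.rightUnitor _).inv))
      naturality_comp f g := IsEqToHom.eq
        ((IsEqToHom.mk (hnat _)).comp
          ((IsEqToHom.mk ((homDiagram D A).map_comp f g)).whiskerLeft _))
        (((IsEqToHom.mk (W.map_comp f g)).whiskerRight _).comp <|
          (IsEqToHom.associator _ _ _).comp <|
          ((IsEqToHom.mk (hnat g)).whiskerLeft _).comp <| (IsEqToHom.associator _ _ _).inv.comp <|
          ((IsEqToHom.mk (hnat f)).whiskerRight _).comp (IsEqToHom.associator _ _ _)) }
  refine ⟨ζ, fun a b f => ⟨hnat f, rfl⟩, ⟨Pseudofunctor.StrongTrans.isoMk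
    (fun (a : LocallyDiscrete Jᵒᵖ) => Cat.Hom.isoMk
      (Discrete.natIso (C := (D.obj (op a) ⟶ A)) (fun _ => θ a.as.unop))) ?_⟩⟩
  · intro a b f
    refine Cat.Hom₂.ext (NatTrans.ext (funext fun ⟨⟨⟩⟩ => ?_))
    have e : IsEqToHom (C := Cat.{u, u}) (a := D.obj (op b)) (b := A) (f := ψ b.as.unop)
        (g := T.map f.as.unop ≫ ψ a.as.unop) ((eqToHom (hnat f)).toNatTrans.app pt) :=
      (IsEqToHom.mk (hnat f)).cat_app (a := D.obj (op b)) (A := A) pt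
    refine (hθ f.as.unop).trans ?_
    change _ = (eqToHom (hnat f)).toNatTrans.app pt ≫ _
    rw [e.eq (IsEqToHom.mk (h f.as.unop))]
    rfl

lemma inclusion_isEquivalence [IsFiltered J]
    (D : StrictPseudofunctor (LocallyDiscrete Jᵒᵖ)ᵒᵖ Cat.{u, u}) (A : Cat.{u, u}) :
    (TwoNat.inclusion (conicalWeight (LocallyDiscrete Jᵒᵖ)) (homDiagram D A)).IsEquivalence where
  essSurj := ⟨fun η => by
    obtain ⟨ζ, hζ, e⟩ := exists_iso_isTwoNatural D A η
    exact ⟨⟨ζ, hζ⟩, e⟩⟩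

/-- A colimit over a filtered category is a bicolimit: the induced functor is the composite of an
isomorphism of categories and the inclusion of cocones into pseudococones. -/
lemma colimitsAreBicolimits_of_isFiltered [IsFiltered J] :
    ColimitsAreBicolimits Cat.{u, u} (conicalWeight (LocallyDiscrete Jᵒᵖ)) := by
  intro D L κ hκ A
  have h₁ : (inducedStrict κ A).IsEquivalence := by
    obtain ⟨G, h, h'⟩ := hκ A
    exact (CategoryTheory.Equivalence.mk (inducedStrict κ A) G (eqToIso h.symm)
      (eqToIso h')).isEquivalence_functor
  have h₂ := inclusion_isEquivalence D A
  exact inferInstanceAs ((inducedStrict κ A ⋙ TwoNat.inclusion _ _).IsEquivalence)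

end Pseudo

end TwoDim

theorem mainTheorem6 (J : Type u) [SmallCategory J] [IsFiltered J] :
    TwoDim.ColimitsAreBicolimits Cat.{u, u} (TwoDim.conicalWeight (LocallyDiscrete Jᵒᵖ)) :=
  TwoDim.colimitsAreBicolimits_of_isFiltered
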